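/- Let $\mathrm{Mat}(n)$ be the set of matroids with ground set $[n]$. For $M\in\mathrm{Mat}(n)$ let the matroid polytope $P(M)\subset\mathbb{R}^n$ be the convex hull of the indicator vectors of the bases of $M$. A matroidal subdivision of $P(M)$ is a polyhedral subdivision $\mathcal{D}$ of $P(M)$ all of whose cells are matroid polytopes of matroids in $\mathrm{Mat}(n)$; here a polyhedral subdivision is a finite set of nonempty polytopes with union $P(M)$ that contains every nonempty face of each of its members and in which any two members meet in a (possibly empty) common face. Let $\mathcal{D}_{in}$ be the set of internal faces of $\mathcal{D}$, that is, the cells of $\mathcal{D}$ not contained in the relative boundary of $P(M)$. A function $f$ from $\mathrm{Mat}(n)$ to an abelian group is valuative if, for every $M\in\mathrm{Mat}(n)$ and every matroidal subdivision $\mathcal{D}$ of $P(M)$, \[f(M)=\sum_{P(N)\in\mathcal{D}_{in}}(-1)^{\dim P(M)-\dim P(N)}f(N).\] For $M\in\mathrm{Mat}(n)$ with rank function $\operatorname{rk}$, and $\operatorname{rk}M=\operatorname{rk}[n]$, define \[s_M(x,y,z)=\sum_{S\subseteq T\subseteq[n]}x^{\#S-\operatorname{rk}S}\,y^{\operatorname{rk}M-\operatorname{rk}T}\,z^{\#T-\#S}\in\mathbb{Z}[x,y,z].\]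 Then, for every $n\ge 0$, the function $M\mapsto s_M$ on $\mathrm{Mat}(n)$ is valuative. Moreover, for every $M\in\mathrm{Mat}(n)$, with $T_M(x,y)=\sum_{S\subseteq[n]}(x-1)^{\operatorname{rk}M-\operatorname{rk}S}(y-1)^{\#S-\operatorname{rk}S}$ the Tutte polynomial of $M$ in its usual normalization, one has $s_M(x-1,y-1,0)=T_M(y,x)$; that is, $s_M(x-1,y-1,0)$ is the Tutte polynomial $t_M(x,y)$ in the normalization in which $x$ records nullity and $y$ records corank. -/

import Mathlib

/-- `Mat(n)`: the matroids whose ground set is all of `[n]`. -/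
abbrev MatroidOn (n : ℕ) : Type := {M : Matroid (Fin n) // M.E = Set.univ}

theorem MatroidOn.finite (n : ℕ) : Finite (MatroidOn n) :=
  Set.Finite.to_subtype <|
    (Matroid.finite_setOfPred_matroid (E := (Set.univ : Set (Fin n))) Set.finite_univ).subset
      fun M _ => Set.subset_univ M.E

noncomputable instance MatroidOn.instFintype (n : ℕ) : Fintype (MatroidOn n) :=
  @Fintype.ofFinite _ (MatroidOn.finite n)

namespace MatroidOn

variable {n : ℕ}

/-- The rank of a set: the maximal size of an independent subset. -/
noncomputable def rk (M : MatroidOn n) (S : Finset (Fin n)) : ℕ :=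
  (M.1.eRk (S : Set (Fin n))).toNat

/-- The rank of the matroid. -/
noncomputable def rank (M : MatroidOn n) : ℕ := M.rk Finset.univ

/-- The matroid polytope: the convex hull in `ℝⁿ` of the indicator vectors of the bases. -/
def polytope (M : MatroidOn n) : Set (Fin n → ℝ) :=
  convexHull ℝ {v | ∃ B : Set (Fin n), M.1.IsBase B ∧ v = B.indicator 1}

end MatroidOn

/-- The dimension of a (nonempty) convex set, that is, of its affine span. -/
noncomputable def convexDim {n : ℕ} (P : Set (Fin n → ℝ)) : ℕ :=
  Module.finrank ℝ (vectorSpan ℝ P)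

/-- `D` is a polyhedral subdivision of `P`: a finite collection of nonempty polytopes that contains
all nonempty faces of its members, in which any two members meet in a common (possibly empty) face,
and whose union is `P`. Faces of a polytope are its exposed subsets. -/
structure IsPolytopalSubdivision {n : ℕ} (D : Set (Set (Fin n → ℝ))) (P : Set (Fin n → ℝ)) :
    Prop where
  finite : D.Finite
  isPolytope : ∀ Q ∈ D, ∃ V : Finset (Fin n → ℝ), V.Nonempty ∧ Q = convexHull ℝ (V : Set (Fin n → ℝ))
  face_mem : ∀ Q ∈ D, ∀ F, IsExposed ℝ Q F → F.Nonempty → F ∈ D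
  inter_face : ∀ Q ∈ D, ∀ R ∈ D, IsExposed ℝ Q (Q ∩ R) ∧ IsExposed ℝ R (Q ∩ R)
  sUnion_eq : ⋃₀ D = P

/-- A matroidal subdivision of `P(M)`: all of its cells are matroid polytopes. -/
structure IsMatroidalSubdivision {n : ℕ} (D : Set (Set (Fin n → ℝ))) (M : MatroidOn n) :
    Prop where
  subdivision : IsPolytopalSubdivision D M.polytope
  matroidal : ∀ Q ∈ D, ∃ N : MatroidOn n, Q = N.polytope

/-- The internal faces of a subdivision `D` of `P`: the cells that do not lie in the (relative)
boundary of `P`. -/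
def internalFaces {n : ℕ} (D : Set (Set (Fin n → ℝ))) (P : Set (Fin n → ℝ)) :
    Set (Set (Fin n → ℝ)) :=
  {Q | Q ∈ D ∧ ¬ Q ⊆ intrinsicFrontier ℝ P}

open Classical in
/-- A function on `Mat(n)` with values in an abelian group is valuative if its value at `M` is the
signed sum of its values over the internal faces of any matroidal subdivision of `P(M)`.
(The cells lie in `P(M)`, so the subtraction of dimensions does not truncate.) -/
def IsValuative {n : ℕ} {A : Type*} [AddCommGroup A] (f : MatroidOn n → A) : Prop :=
  ∀ (M : MatroidOn n) (D : Set (Set (Fin n → ℝ))), IsMatroidalSubdivision D M →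
    f M = ∑ N : MatroidOn n with N.polytope ∈ internalFaces D M.polytope,
      (-1 : ℤ) ^ (convexDim M.polytope - convexDim N.polytope) • f N

open MvPolynomial in
/-- `s_M(x, y, z)`, with `x, y, z` the variables `X 0, X 1, X 2`. No exponent truncates. -/
noncomputable def tutteLike {n : ℕ} (M : MatroidOn n) : MvPolynomial (Fin 3) ℤ :=
  ∑ T : Finset (Fin n), ∑ S ∈ T.powerset,
    X 0 ^ (S.card - M.rk S) * X 1 ^ (M.rank - M.rk T) * X 2 ^ (T.card - S.card)

open MvPolynomial in
/-- The Tutte polynomial `T_M(x, y) = ∑_A (x-1)^(rk M - rk A) (y-1)^(#A - rk A)`, in its usual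
normalization (a coloop contributes `x`, a loop `y`), with `x, y` the variables `X 0, X 1`. -/
noncomputable def tuttePolynomial {n : ℕ} (M : MatroidOn n) : MvPolynomial (Fin 2) ℤ :=
  ∑ S : Finset (Fin n), (X 0 - 1) ^ (M.rank - M.rk S) * (X 1 - 1) ^ (S.card - M.rk S)

/-! Each summand of `tutteLike` with `S ⊆ T` fixed is a function of `rk S` and `rk T`, because all
cells of a matroidal subdivision have the same total rank. By linearity and inclusion-exclusion it
suffices to treat the indicator of `a ≤ rk S ∧ b ≤ rk T`. Some base attains both ranks at once,
since `S` and `T` are nested, so this condition says that `P(M)` meets a fixed open convex set `U`,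
an intersection of two half-spaces (`polytope_inter_sumExceeds_nonempty`).

If `P` meets `U`, then `relint P ∩ U` is relatively open and convex of dimension `dim P`, so its
compactly supported Euler characteristic is `(-1) ^ dim P`; otherwise it is zero. The relative
interior of `P(M)` is the disjoint union of the relative interiors of the internal faces, so
additivity of the Euler characteristic is, up to sign, the valuative relation. Additivity
(`sum_mul_openEuler_eq_zero`) is proved by slicing along one coordinate at a time, which reduces it
to points and open intervals of the line.

The Tutte specialization holds because `z = 0` leaves only the terms with `S = T`. -/

/-- The algebraic relative interior of a convex set: the points at which every segment of the set
ending there can be prolonged. -/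
def algRelInt {E : Type*} [AddCommGroup E] [Module ℝ E] (P : Set E) : Set E :=
  {x | x ∈ P ∧ ∀ y ∈ P, ∃ δ : ℝ, 0 < δ ∧ x + δ • (x - y) ∈ P}

/-! ### Relative interiors of convex sets, algebraically. -/

section algRelInt

variable {E : Type*} [AddCommGroup E] [Module ℝ E] {P W : Set E} {p q r v : E}

theorem algRelInt_subset : algRelInt P ⊆ P := fun _ h => h.1

theorem Convex.add_smul_mem_of_le (hP : Convex ℝ P) (hp : p ∈ P) {δ ε : ℝ} (hδ : p + δ • v ∈ P)
    (h0 : 0 ≤ ε) (hle : ε ≤ δ) : p + ε • v ∈ P := by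
  rcases h0.eq_or_lt with rfl | h0
  · simpa using hp
  have hδ0 : 0 < δ := h0.trans_le hle
  have := hP.add_smul_mem hp hδ (t := ε / δ) ⟨by positivity, (div_le_one hδ0).2 hle⟩
  rwa [smul_smul, div_mul_cancel₀ _ hδ0.ne'] at this

/-- The directions that can be followed from `p` for a positive time are closed under addition by
taking midpoints, and under negation because segments ending at `p` can be prolonged. They contain
`P - p`, hence its span. -/
theorem exists_add_smul_mem_of_mem_algRelInt (hP : Convex ℝ P) (hp : p ∈ algRelInt P)
    (hv : v ∈ vectorSpan ℝ P) : ∃ δ : ℝ, 0 < δ ∧ p + δ • v ∈ P := by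
  rw [vectorSpan_eq_span_vsub_set_right ℝ hp.1] at hv
  induction hv using Submodule.span_induction with
  | mem v hv =>
    obtain ⟨y, hy, rfl⟩ := hv
    exact ⟨1, one_pos, by simpa using hy⟩
  | zero => exact ⟨1, one_pos, by simpa using hp.1⟩
  | add v w _ _ hv hw =>
    obtain ⟨a, ha, hav⟩ := hv
    obtain ⟨b, hb, hbw⟩ := hw
    have h1 := hP.add_smul_mem_of_le hp.1 hav (le_min ha.le hb.le) (min_le_left a b)
    have h2 := hP.add_smul_mem_of_le hp.1 hbw (le_min ha.le hb.le) (min_le_right a b)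
    refine ⟨min a b / 2, by positivity, ?_⟩
    convert hP h1 h2 (a := 1 / 2) (b := 1 / 2) (by norm_num) (by norm_num) (by norm_num) using 1
    module
  | smul c v _ hv =>
    obtain ⟨a, ha, hav⟩ := hv
    rcases lt_trichotomy c 0 with hc | rfl | hc
    · obtain ⟨η, hη, h⟩ := hp.2 _ hav
      refine ⟨η * a / (-c), div_pos (mul_pos hη ha) (by linarith), ?_⟩
      convert h using 1
      rw [smul_smul, div_mul_eq_mul_div, mul_comm (η * a) c, div_neg, mul_div_cancel_left₀ _ hc.ne]
      module
    · exact ⟨1, one_pos, by simpa using hp.1⟩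
    · refine ⟨a / c, by positivity, ?_⟩
      rwa [smul_smul, div_mul_cancel₀ _ hc.ne']

/-- A point strictly between a point of the relative interior and a point of the set lies in the
relative interior. -/
theorem add_smul_mem_algRelInt (hP : Convex ℝ P) (hp : p ∈ algRelInt P) (hr : r ∈ P) {s : ℝ}
    (hs0 : 0 ≤ s) (hs1 : s < 1) : p + s • (r - p) ∈ algRelInt P := by
  have hq : p + s • (r - p) ∈ P := hP.add_smul_sub_mem hp.1 hr ⟨hs0, hs1.le⟩
  refine ⟨hq, fun y hy => ?_⟩
  obtain ⟨δ, hδ, h⟩ := exists_add_smul_mem_of_mem_algRelInt hP hp (vsub_mem_vectorSpan ℝ hq hy)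
  refine ⟨(1 - s) * δ, mul_pos (by linarith) hδ, ?_⟩
  convert hP h hr (a := 1 - s) (b := s) (by linarith) hs0 (by ring) using 1
  rw [vsub_eq_sub]
  module

theorem mem_algRelInt_of_between (hP : Convex ℝ P) (hp : p ∈ algRelInt P) {δ : ℝ} (hδ : 0 < δ)
    (hr : q + δ • (q - p) ∈ P) : q ∈ algRelInt P := by
  have h := add_smul_mem_algRelInt hP hp hr (s := 1 / (1 + δ)) (by positivity)
    ((div_lt_one (by positivity)).2 (by linarith))
  convert h using 1
  have : q + δ • (q - p) - p = (1 + δ) • (q - p) := by module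
  rw [this, smul_smul, one_div, inv_mul_cancel₀ (by positivity)]
  module

theorem convex_algRelInt (hP : Convex ℝ P) : Convex ℝ (algRelInt P) := by
  intro x hx y hy a b ha hb hab
  rcases hb.eq_or_lt with rfl | hb
  · simpa [show a = 1 by linarith] using hx
  rcases ha.eq_or_lt with rfl | ha
  · simpa [show b = 1 by linarith] using hy
  convert add_smul_mem_algRelInt hP hx hy.1 hb.le (by linarith) using 1
  rw [show a = 1 - b by linarith]
  module

theorem algRelInt_idem (hP : Convex ℝ P) : algRelInt P ⊆ algRelInt (algRelInt P) := by
  refine fun x hx => ⟨hx, fun y hy => ?_⟩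
  obtain ⟨δ, hδ, h⟩ := hx.2 y hy.1
  refine ⟨δ / 2, by positivity, ?_⟩
  convert add_smul_mem_algRelInt hP hx h (s := 1 / 2) (by norm_num) (by norm_num) using 1
  module

/-- If `R` is convex, meets the relative interior of `P` and is contained in `P`, then its relative
interior is contained in that of `P`. -/
theorem algRelInt_subset_algRelInt {R : Set E} (hP : Convex ℝ P) (hRP : R ⊆ P)
    (h : (R ∩ algRelInt P).Nonempty) : algRelInt R ⊆ algRelInt P := by
  obtain ⟨p, hpR, hp⟩ := h
  intro q hq
  obtain ⟨δ, hδ, h⟩ := hq.2 p hpR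
  exact mem_algRelInt_of_between hP hp hδ (hRP h)

end algRelInt

/-! ### Comparison with the topological relative interior; exposed faces. -/

section topology

variable {E : Type*} [NormedAddCommGroup E] [NormedSpace ℝ E] {P U : Set E} {p : E}

theorem eventually_add_smul_mem (hU : IsOpen U) (hp : p ∈ U) (v : E) :
    ∃ δ : ℝ, 0 < δ ∧ ∀ ε, 0 ≤ ε → ε ≤ δ → p + ε • v ∈ U := by
  have hc : Continuous fun t : ℝ => p + t • v := by fun_prop
  obtain ⟨δ, hδ, h⟩ := Metric.isOpen_iff.1 (hU.preimage hc) 0 (by simpa using hp)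
  refine ⟨δ / 2, by positivity, fun ε h0 h1 => h ?_⟩
  rw [Metric.mem_ball, Real.dist_eq, sub_zero, abs_of_nonneg h0]
  linarith

theorem algRelInt_inter_isOpen (hP : Convex ℝ P) (hU : IsOpen U) :
    algRelInt P ∩ U ⊆ algRelInt (algRelInt P ∩ U) := by
  refine fun x hx => ⟨hx, fun y hy => ?_⟩
  obtain ⟨δ, hδ, h⟩ := (algRelInt_idem hP hx.1).2 y hy.1
  obtain ⟨η, hη, h'⟩ := eventually_add_smul_mem hU hx.2 (x - y)
  exact ⟨min δ η, lt_min hδ hη, (convex_algRelInt hP).add_smul_mem_of_le hx.1 h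
    (le_min hδ.le hη.le) (min_le_left _ _), h' _ (le_min hδ.le hη.le) (min_le_right _ _)⟩

/-- Cutting with an open set loses no dimension: every direction of `P` can be followed a little
from a point of the intersection. -/
theorem vectorSpan_algRelInt_inter_isOpen (hP : Convex ℝ P) (hU : IsOpen U)
    (h : (algRelInt P ∩ U).Nonempty) : vectorSpan ℝ (algRelInt P ∩ U) = vectorSpan ℝ P := by
  refine le_antisymm (vectorSpan_mono ℝ (Set.inter_subset_left.trans algRelInt_subset)) ?_
  obtain ⟨p, hp, hpU⟩ := h
  intro v hv
  obtain ⟨δ, hδ, h⟩ := exists_add_smul_mem_of_mem_algRelInt hP hp hv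
  obtain ⟨η, hη, h'⟩ := eventually_add_smul_mem hU hpU v
  have h1 : p + (δ / 2) • v ∈ algRelInt P := by
    convert add_smul_mem_algRelInt hP hp h (s := 1 / 2) (by norm_num) (by norm_num) using 1
    module
  have hpos : 0 < min (δ / 2) η := lt_min (by positivity) hη
  have h2 : p + min (δ / 2) η • v ∈ algRelInt P ∩ U :=
    ⟨(convex_algRelInt hP).add_smul_mem_of_le hp h1 hpos.le (min_le_left _ _),
      h' _ hpos.le (min_le_right _ _)⟩
  have h3 := vsub_mem_vectorSpan ℝ h2 (show p ∈ algRelInt P ∩ U from ⟨hp, hpU⟩)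
  rw [vsub_eq_sub, add_sub_cancel_left] at h3
  exact ((vectorSpan ℝ _).smul_mem_iff hpos.ne').1 h3

theorem mem_intrinsicInterior_iff_ball : p ∈ intrinsicInterior ℝ P ↔
    p ∈ P ∧ ∃ ε : ℝ, 0 < ε ∧ ∀ v ∈ vectorSpan ℝ P, ‖v‖ < ε → p + v ∈ P := by
  rw [mem_intrinsicInterior]
  constructor
  · rintro ⟨y, hy, rfl⟩
    have hyP : (y : E) ∈ P := interior_subset (s := ((↑) ⁻¹' P : Set (affineSpan ℝ P))) hy
    refine ⟨hyP, ?_⟩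
    rw [mem_interior_iff_mem_nhds, Metric.mem_nhds_iff] at hy
    obtain ⟨ε, hε, h⟩ := hy
    refine ⟨ε, hε, fun v hv hvε => ?_⟩
    have hm : (y : E) + v ∈ affineSpan ℝ P := by
      rw [add_comm]
      exact AffineSubspace.vadd_mem_of_mem_direction (by rwa [direction_affineSpan]) y.2
    exact h (a := ⟨(y : E) + v, hm⟩) (by simpa [Subtype.dist_eq] using hvε)
  · rintro ⟨hp, ε, hε, h⟩
    refine ⟨⟨p, subset_affineSpan ℝ P hp⟩, ?_, rfl⟩
    rw [mem_interior_iff_mem_nhds, Metric.mem_nhds_iff]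
    refine ⟨ε, hε, fun z hz => ?_⟩
    have hv : (z : E) - p ∈ vectorSpan ℝ P := by
      rw [← direction_affineSpan]
      exact AffineSubspace.vsub_mem_direction z.2 (subset_affineSpan ℝ P hp)
    have := h _ hv (by simpa [Subtype.dist_eq, dist_eq_norm] using hz)
    simpa using this

theorem intrinsicInterior_eq_algRelInt [FiniteDimensional ℝ E] (hP : Convex ℝ P) :
    intrinsicInterior ℝ P = algRelInt P := by
  refine Set.Subset.antisymm (fun p hp => ?_) fun p hp => ?_
  · obtain ⟨hpP, ε, hε, h⟩ := mem_intrinsicInterior_iff_ball.1 hp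
    refine ⟨hpP, fun y hy => ?_⟩
    obtain ⟨δ, hδ, h'⟩ := eventually_add_smul_mem Metric.isOpen_ball
      (Metric.mem_ball_self (x := (0 : E)) hε) (p - y)
    refine ⟨δ, hδ, h _ (Submodule.smul_mem _ _ (vsub_mem_vectorSpan ℝ hpP hy)) ?_⟩
    simpa using h' δ hδ.le le_rfl
  · obtain ⟨z, hz⟩ := Set.Nonempty.intrinsicInterior hP ⟨p, hp.1⟩
    obtain ⟨hzP, ε, hε, h⟩ := mem_intrinsicInterior_iff_ball.1 hz
    obtain ⟨δ, hδ, hr⟩ := hp.2 z hzP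
    -- With `r = p + δ • (p - z)` one has `p = (δ z + r) / (1 + δ)`, so the homothety centred at `r`
    -- with ratio `δ / (1 + δ)` carries the `ε`-ball about `z` to one about `p`.
    refine mem_intrinsicInterior_iff_ball.2 ⟨hp.1, ε * (δ / (1 + δ)), by positivity, fun v hv hvε => ?_⟩
    have h1 : z + ((1 + δ) / δ) • v ∈ P := by
      refine h _ (Submodule.smul_mem _ _ hv) ?_
      rw [norm_smul, Real.norm_of_nonneg (by positivity)]
      calc (1 + δ) / δ * ‖v‖ < (1 + δ) / δ * (ε * (δ / (1 + δ))) := by gcongr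
        _ = ε := by field_simp
    convert hP h1 hr (a := δ / (1 + δ)) (b := 1 / (1 + δ)) (by positivity) (by positivity)
      (by field_simp; ring) using 1
    match_scalars <;> field_simp
    ring

theorem algRelInt_nonempty [FiniteDimensional ℝ E] (hP : Convex ℝ P) (h : P.Nonempty) :
    (algRelInt P).Nonempty := by
  rw [← intrinsicInterior_eq_algRelInt hP]
  exact h.intrinsicInterior hP

/-- An open set that meets a convex set meets its relative interior. -/
theorem algRelInt_inter_isOpen_nonempty [FiniteDimensional ℝ E] (hP : Convex ℝ P) (hU : IsOpen U)
    (h : (P ∩ U).Nonempty) : (algRelInt P ∩ U).Nonempty := by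
  obtain ⟨x, hx, hxU⟩ := h
  obtain ⟨z, hz⟩ := algRelInt_nonempty hP ⟨x, hx⟩
  obtain ⟨δ, hδ, h⟩ := eventually_add_smul_mem hU hxU (z - x)
  have hpos : 0 < min δ 1 := lt_min hδ one_pos
  refine ⟨x + min δ 1 • (z - x), ?_, h _ hpos.le (min_le_left _ _)⟩
  convert add_smul_mem_algRelInt hP hz hx (s := 1 - min δ 1)
    (by linarith [min_le_right δ 1]) (by linarith) using 1
  module

/-- A face that contains a point of the relative interior is the whole set. -/
theorem IsExposed.eq_of_mem_algRelInt {F : Set E} (hF : IsExposed ℝ P F) (hpF : p ∈ F)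
    (hp : p ∈ algRelInt P) : F = P := by
  obtain ⟨l, rfl⟩ := hF ⟨p, hpF⟩
  refine Set.Subset.antisymm (fun x hx => hx.1) fun x hx => ⟨hx, fun y hy => ?_⟩
  obtain ⟨δ, hδ, h⟩ := hp.2 x hx
  have h1 := hpF.2 _ h
  have h2 := hpF.2 y hy
  simp only [map_add, map_smul, map_sub, smul_eq_mul] at h1
  nlinarith

/-- A point of a convex set outside the relative interior lies on a proper exposed face. -/
theorem exists_isExposed_of_notMem_algRelInt [FiniteDimensional ℝ E] (hP : Convex ℝ P)
    (hpP : p ∈ P) (hp : p ∉ algRelInt P) : ∃ F, IsExposed ℝ P F ∧ p ∈ F ∧ F ≠ P := by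
  -- Translated by `-p` and viewed inside its own direction space, `P` has nonempty interior, and
  -- `0` can be separated from that interior.
  set V := vectorSpan ℝ P
  set Q : Set V := {v | p + (v : E) ∈ P} with hQdef
  have hQ : Convex ℝ Q := by
    intro v hv w hw a b ha hb hab
    have := hP hv hw ha hb hab
    simp only [hQdef, Set.mem_ofPred_eq, Submodule.coe_add, Submodule.coe_smul]
    convert this using 1
    rw [show a = 1 - b by linarith]
    module
  have h0 : (0 : V) ∉ interior Q := by
    intro h0
    rw [mem_interior_iff_mem_nhds, Metric.mem_nhds_iff] at h0
    obtain ⟨ε, hε, h⟩ := h0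
    refine hp ?_
    rw [← intrinsicInterior_eq_algRelInt hP, mem_intrinsicInterior_iff_ball]
    exact ⟨hpP, ε, hε, fun v hv hvε => h (a := ⟨v, hv⟩) (by simpa using hvε)⟩
  obtain ⟨z, hz⟩ := hP |> fun h => Set.Nonempty.intrinsicInterior h ⟨p, hpP⟩
  obtain ⟨hzP, ε, hε, hz⟩ := mem_intrinsicInterior_iff_ball.1 hz
  have hzi : (⟨z - p, vsub_mem_vectorSpan ℝ hzP hpP⟩ : V) ∈ interior Q := by
    rw [mem_interior_iff_mem_nhds, Metric.mem_nhds_iff]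
    refine ⟨ε, hε, fun w hw => ?_⟩
    have := hz (w - (z - p)) (V.sub_mem w.2 (vsub_mem_vectorSpan ℝ hzP hpP))
      (by simpa [Subtype.dist_eq, dist_eq_norm] using hw)
    simp only [hQdef, Set.mem_ofPred_eq]
    convert this using 1
    abel
  obtain ⟨f, hf⟩ := geometric_hahn_banach_open_point hQ.interior isOpen_interior h0
  have hle : ∀ v ∈ Q, f v ≤ 0 := by
    intro v hv
    have hcl : v ∈ closure (interior Q) := by
      rw [hQ.closure_interior_eq_closure_of_nonempty_interior ⟨_, hzi⟩]
      exact subset_closure hv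
    have : closure (interior Q) ⊆ {v | f v ≤ 0} :=
      closure_minimal (fun w hw => by simpa using (hf w hw).le)
        (isClosed_le f.continuous continuous_const)
    exact this hcl
  obtain ⟨g, hg⟩ := LinearMap.exists_extend (f : V →ₗ[ℝ] ℝ)
  have hgf : ∀ v : V, g v = f v := fun v => LinearMap.congr_fun hg v
  have hgle : ∀ y ∈ P, g y ≤ g p := by
    intro y hy
    have := hle ⟨y - p, vsub_mem_vectorSpan ℝ hy hpP⟩ (by simpa [hQdef] using hy)
    rw [← hgf, map_sub] at this
    linarith
  refine ⟨{x | x ∈ P ∧ ∀ y ∈ P, g y ≤ g x}, fun _ => ⟨LinearMap.toContinuousLinearMap g, rfl⟩,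
    ⟨hpP, hgle⟩, fun hEq => ?_⟩
  -- The face is proper: `f` is strictly negative at the interior point `z - p`, while `z` in the
  -- face would give `g p ≤ g z`.
  have h1 := (hEq.symm ▸ hzP : z ∈ {x | x ∈ P ∧ ∀ y ∈ P, g y ≤ g x}).2 p hpP
  have h2 := hf _ hzi
  rw [map_zero, ← hgf, map_sub] at h2
  linarith

end topology

/-! ### Euler characteristics of relatively open convex sets. -/

open Classical in
/-- The Euler characteristic with compact support of a relatively open convex set. -/
noncomputable def openEuler {n : ℕ} (W : Set (Fin n → ℝ)) : ℤ :=
  if W.Nonempty then (-1) ^ convexDim W else 0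

section Euler

variable {ι : Type*}

-- The value minus the right limit of the indicator is supported at one point, where it is the Euler
-- characteristic: `1` at a point, `0 - 1` at the left end of an open interval. At the right end
-- both terms vanish.
open Filter Topology in
theorem exists_rightLimit_of_point_or_Ioo {J : Set ℝ} {e : ℤ}
    (hJ : (∃ a, J = {a} ∧ e = 1) ∨ ∃ a b, a < b ∧ J = Set.Ioo a b ∧ e = -1) :
    ∃ (a : ℝ) (L : ℝ → ℤ), (∀ t, ∀ᶠ u in 𝓝[>] t, J.indicator (1 : ℝ → ℤ) u = L t) ∧
      ∀ t, J.indicator (1 : ℝ → ℤ) t - L t = if t = a then e else 0 := by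
  rcases hJ with ⟨a, rfl, rfl⟩ | ⟨a, b, hab, rfl, rfl⟩
  · refine ⟨a, 0, fun t => ?_, fun t => by simp [Set.indicator_apply]⟩
    rcases lt_or_ge t a with h | h
    · filter_upwards [Ioo_mem_nhdsGT h] with u hu
      simp [hu.2.ne]
    · filter_upwards [self_mem_nhdsWithin] with u hu
      simp [(h.trans_lt hu).ne']
  · refine ⟨a, (Set.Ico a b).indicator 1, fun t => ?_, fun t => ?_⟩
    · rcases lt_or_ge t a with h | h
      · filter_upwards [Ioo_mem_nhdsGT h] with u hu
        rw [Set.indicator_of_notMem (fun h' => hu.2.not_gt h'.1),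
          Set.indicator_of_notMem (fun h' => h.not_ge h'.1)]
      rcases lt_or_ge t b with h' | h'
      · filter_upwards [Ioo_mem_nhdsGT h'] with u hu
        rw [Set.indicator_of_mem (show u ∈ Set.Ioo a b from ⟨h.trans_lt hu.1, hu.2⟩),
          Set.indicator_of_mem (show t ∈ Set.Ico a b from ⟨h, h'⟩)]
        rfl
      · filter_upwards [self_mem_nhdsWithin] with u hu
        rw [Set.indicator_of_notMem (fun h'' => (h'.trans_lt hu).not_gt h''.2),
          Set.indicator_of_notMem (fun h'' => h'.not_gt h''.2)]
    · rcases lt_trichotomy t a with h | rfl | h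
      · simp [h.not_ge, h.not_gt, h.ne]
      · simp [hab]
      · simp [Set.indicator_apply, h, h.le, h.ne']

/-- A linear relation between indicator functions of points and bounded open intervals of the line
holds between their Euler characteristics. -/
theorem sum_mul_eq_zero_of_sum_indicator_line (s : Finset ι) (c e : ι → ℤ) (J : ι → Set ℝ)
    (hJ : ∀ i ∈ s, (∃ a, J i = {a} ∧ e i = 1) ∨ ∃ a b, a < b ∧ J i = Set.Ioo a b ∧ e i = -1)
    (h : ∀ t, ∑ i ∈ s, c i * (J i).indicator (1 : ℝ → ℤ) t = 0) : ∑ i ∈ s, c i * e i = 0 := by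
  classical
  have key : ∀ i, ∃ (a : ℝ) (L : ℝ → ℤ), i ∈ s →
      (∀ t, ∀ᶠ u in nhdsWithin t (Set.Ioi t), (J i).indicator (1 : ℝ → ℤ) u = L t) ∧
      ∀ t, (J i).indicator (1 : ℝ → ℤ) t - L t = if t = a then e i else 0 := by
    intro i
    by_cases hi : i ∈ s
    · obtain ⟨a, L, h⟩ := exists_rightLimit_of_point_or_Ioo (hJ i hi)
      exact ⟨a, L, fun _ => h⟩
    · exact ⟨0, 0, fun h => absurd h hi⟩
  choose a L haL using key
  -- The relation passes to right limits, so the jumps satisfy it too; adding them over all `t`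
  -- gives the claim.
  have hL : ∀ t, ∑ i ∈ s, c i * L i t = 0 := by
    intro t
    have : ∀ᶠ u in nhdsWithin t (Set.Ioi t), ∀ i ∈ s, (J i).indicator (1 : ℝ → ℤ) u = L i t :=
      (Filter.eventually_all_finset s).2 fun i hi => (haL i hi).1 t
    obtain ⟨u, hu⟩ := this.exists
    rw [← h u]
    exact Finset.sum_congr rfl fun i hi => by rw [hu i hi]
  calc ∑ i ∈ s, c i * e i
      = ∑ i ∈ s, ∑ t ∈ s.image a, c i * ((J i).indicator (1 : ℝ → ℤ) t - L i t) := by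
        refine Finset.sum_congr rfl fun i hi => ?_
        rw [← Finset.mul_sum, Finset.sum_congr rfl fun t _ => (haL i hi).2 t,
          Finset.sum_ite_eq', if_pos (Finset.mem_image_of_mem a hi)]
    _ = ∑ t ∈ s.image a, ∑ i ∈ s, c i * ((J i).indicator (1 : ℝ → ℤ) t - L i t) :=
        Finset.sum_comm
    _ = 0 := by
        refine Finset.sum_eq_zero fun t _ => ?_
        simp only [mul_sub, Finset.sum_sub_distrib, h, hL, sub_self]

theorem eq_Ioo_of_subset_algRelInt {J : Set ℝ} (hJ : Convex ℝ J) (ho : J ⊆ algRelInt J)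
    (hb : Bornology.IsBounded J) (hn : J.Nontrivial) : ∃ a b, a < b ∧ J = Set.Ioo a b := by
  have hB := hb.bddBelow
  have hA := hb.bddAbove
  have hlt : ∀ x ∈ J, sInf J < x ∧ x < sSup J := by
    intro x hx
    obtain ⟨y, hy, hyx⟩ := hn.exists_ne x
    obtain ⟨δ, hδ, hz⟩ := (ho hx).2 y hy
    rw [smul_eq_mul] at hz
    rcases lt_or_gt_of_ne hyx with h | h
    · have := mul_pos hδ (sub_pos.2 h)
      exact ⟨(csInf_le hB hy).trans_lt h, by linarith [le_csSup hA hz]⟩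
    · have := mul_pos hδ (sub_pos.2 h)
      exact ⟨by nlinarith [csInf_le hB hz], h.trans_le (le_csSup hA hy)⟩
  obtain ⟨x, hx⟩ := hn.nonempty
  refine ⟨sInf J, sSup J, (hlt x hx).1.trans (hlt x hx).2, Set.Subset.antisymm hlt fun y hy => ?_⟩
  obtain ⟨u, hu, huy⟩ := exists_lt_of_csInf_lt hn.nonempty hy.1
  obtain ⟨w, hw, hyw⟩ := exists_lt_of_lt_csSup hn.nonempty hy.2
  exact hJ.ordConnected.out hu hw ⟨huy.le, hyw.le⟩

theorem Submodule.finrank_inf_ker_add_one {V : Type*} [AddCommGroup V] [Module ℝ V]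
    [FiniteDimensional ℝ V] (S : Submodule ℝ V) (f : V →ₗ[ℝ] ℝ) {v : V} (hv : v ∈ S)
    (hfv : f v ≠ 0) :
    Module.finrank ℝ (S ⊓ LinearMap.ker f : Submodule ℝ V) + 1 = Module.finrank ℝ S := by
  have hne : f.domRestrict S ≠ 0 := fun h => hfv (by simpa using LinearMap.congr_fun h ⟨v, hv⟩)
  rw [← Module.Dual.finrank_ker_add_one_of_ne_zero (f := f.domRestrict S) hne,
    LinearMap.ker_domRestrict, ← Submodule.finrank_map_subtype_eq, Submodule.map_comap_subtype]

variable {n : ℕ}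

/-- As `W` is relatively open, the slice spans all directions of `W` with zero `j`-th coordinate, a
hyperplane of the direction space because coordinate `j` varies on `W`. -/
theorem convexDim_slice_add_one {W : Set (Fin n → ℝ)} (hW : Convex ℝ W) (ho : W ⊆ algRelInt W)
    {j : Fin n} {t : ℝ} (ht : (W ∩ {x | x j = t}).Nonempty) {x y : Fin n → ℝ} (hx : x ∈ W)
    (hy : y ∈ W) (hxy : x j ≠ y j) : convexDim (W ∩ {x | x j = t}) + 1 = convexDim W := by
  have hspan : vectorSpan ℝ (W ∩ {x | x j = t}) =
      vectorSpan ℝ W ⊓ LinearMap.ker (LinearMap.proj j : (Fin n → ℝ) →ₗ[ℝ] ℝ) := by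
    refine le_antisymm (le_inf (vectorSpan_mono ℝ Set.inter_subset_left) ?_) ?_
    · rw [vectorSpan_def, Submodule.span_le]
      rintro _ ⟨u, hu, w, hw, rfl⟩
      have h1 : u j = t := hu.2
      have h2 : w j = t := hw.2
      simp [h1, h2]
    · rintro v ⟨hv, hvj⟩
      have hvj : v j = 0 := hvj
      obtain ⟨p, hp, hpt⟩ := ht
      have hpt : p j = t := hpt
      obtain ⟨δ, hδ, h⟩ := exists_add_smul_mem_of_mem_algRelInt hW (ho hp) hv
      have h1 : p + δ • v ∈ W ∩ {x | x j = t} := ⟨h, by simp [hvj, hpt]⟩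
      have h3 := vsub_mem_vectorSpan ℝ h1 (show p ∈ W ∩ {x | x j = t} from ⟨hp, hpt⟩)
      rw [vsub_eq_sub, add_sub_cancel_left] at h3
      exact ((vectorSpan ℝ _).smul_mem_iff hδ.ne').1 h3
  unfold convexDim
  rw [hspan]
  exact Submodule.finrank_inf_ker_add_one _ _ (vsub_mem_vectorSpan ℝ hx hy)
    (by simpa [sub_eq_zero] using hxy)

/-- A Fubini formula: `e` is the Euler characteristic of the projection of `W` to the `j`-th axis,
either a point or an open interval. In the second case nonempty slices lose one dimension. -/
theorem openEuler_slice {W : Set (Fin n → ℝ)} (hW : Convex ℝ W) (ho : W ⊆ algRelInt W)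
    (hb : Bornology.IsBounded W) (hne : W.Nonempty) (j : Fin n) : ∃ e : ℤ,
      ((∃ a, (fun x => x j) '' W = {a} ∧ e = 1) ∨
        ∃ a b, a < b ∧ (fun x => x j) '' W = Set.Ioo a b ∧ e = -1) ∧
      ∀ t, openEuler (W ∩ {x | x j = t}) =
        openEuler W * e * ((fun x => x j) '' W).indicator (1 : ℝ → ℤ) t := by
  have hslice : ∀ t, (W ∩ {x | x j = t}).Nonempty ↔ t ∈ (fun x => x j) '' W := fun t => Iff.rfl
  by_cases hc : ∀ x ∈ W, ∀ y ∈ W, x j = y j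
  · obtain ⟨z, hz⟩ := hne
    have him : (fun x => x j) '' W = {z j} := by
      refine Set.eq_singleton_iff_unique_mem.2 ⟨⟨z, hz, rfl⟩, ?_⟩
      rintro _ ⟨x, hx, rfl⟩
      exact hc x hx z hz
    refine ⟨1, Or.inl ⟨z j, him, rfl⟩, fun t => ?_⟩
    by_cases ht : t ∈ (fun x => x j) '' W
    · rw [Set.indicator_of_mem ht]
      obtain ⟨x, hx, rfl⟩ := ht
      have : W ∩ {y | y j = x j} = W := Set.inter_eq_left.2 fun y hy => hc y hy x hx
      simp [this]
    · rw [Set.indicator_of_notMem ht, openEuler, if_neg (mt (hslice t).1 ht), mul_zero]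
  · push Not at hc
    obtain ⟨x, hx, y, hy, hxy⟩ := hc
    obtain ⟨a, b, hab, h⟩ := eq_Ioo_of_subset_algRelInt (J := (fun x => x j) '' W)
      (hW.linear_image (LinearMap.proj j : (Fin n → ℝ) →ₗ[ℝ] ℝ))
      (by
        rintro _ ⟨u, hu, rfl⟩
        refine ⟨⟨u, hu, rfl⟩, ?_⟩
        rintro _ ⟨w, hw, rfl⟩
        obtain ⟨δ, hδ, h⟩ := (ho hu).2 w hw
        exact ⟨δ, hδ, _, h, by simp⟩)
      (hb.image_eval j)
      ⟨_, ⟨x, hx, rfl⟩, _, ⟨y, hy, rfl⟩, hxy⟩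
    refine ⟨-1, Or.inr ⟨a, b, hab, h, rfl⟩, fun t => ?_⟩
    by_cases ht : t ∈ (fun x => x j) '' W
    · rw [Set.indicator_of_mem ht, openEuler, openEuler, if_pos ((hslice t).2 ht), if_pos hne,
        ← convexDim_slice_add_one hW ho ((hslice t).2 ht) hx hy hxy]
      simp [pow_succ]
    · rw [Set.indicator_of_notMem ht, openEuler, if_neg (mt (hslice t).1 ht), mul_zero]

theorem openEuler_singleton (p : Fin n → ℝ) : openEuler {p} = 1 := by
  rw [openEuler, if_pos (Set.singleton_nonempty p), convexDim, vectorSpan_singleton, finrank_bot,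
    pow_zero]

/-- Induction on the set `K` of coordinates allowed to vary. With none left, all nonempty `W i` are
the same point; otherwise slicing along `j ∈ K` frees the induction hypothesis of that coordinate.
-/
theorem sum_mul_openEuler_eq_zero_of_eqOn_compl (K : Finset (Fin n)) (s : Finset ι) (c : ι → ℤ)
    (W : ι → Set (Fin n → ℝ)) (hW : ∀ i ∈ s, Convex ℝ (W i))
    (ho : ∀ i ∈ s, W i ⊆ algRelInt (W i)) (hb : ∀ i ∈ s, Bornology.IsBounded (W i))
    (hK : ∀ i ∈ s, ∀ i' ∈ s, ∀ x ∈ W i, ∀ y ∈ W i', ∀ j ∉ K, x j = y j)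
    (h : ∀ p, ∑ i ∈ s, c i * (W i).indicator (1 : (Fin n → ℝ) → ℤ) p = 0) :
    ∑ i ∈ s, c i * openEuler (W i) = 0 := by
  induction K using Finset.induction_on generalizing W with
  | empty =>
    by_cases hne : ∃ i ∈ s, (W i).Nonempty
    · obtain ⟨i, hi, p, hp⟩ := hne
      rw [← h p]
      refine Finset.sum_congr rfl fun i' hi' => ?_
      congr 1
      rcases (W i').eq_empty_or_nonempty with h0 | ⟨q, hq⟩
      · simp [h0, openEuler]
      · have : W i' = {p} := by
          refine Set.eq_singleton_iff_unique_mem.2 ⟨?_, fun x hx => ?_⟩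
          · rwa [show p = q from funext fun j => hK i hi i' hi' p hp q hq j (Finset.notMem_empty j)]
          · exact funext fun j => hK i' hi' i hi x hx p hp j (Finset.notMem_empty j)
        simp [this, openEuler_singleton]
    · push Not at hne
      refine Finset.sum_eq_zero fun i hi => ?_
      simp [hne i hi, openEuler]
  | insert j K hj ih =>
    classical
    -- Empty sets contribute nothing, but their projections are neither points nor intervals, so
    -- they are discarded.
    set s' := s.filter fun i => (W i).Nonempty with hs'
    have hss : ∀ i ∈ s', i ∈ s := fun i hi => (Finset.mem_filter.1 hi).1
    have key : ∀ i, ∃ e : ℤ, i ∈ s' →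
        ((∃ a, (fun x => x j) '' W i = {a} ∧ e = 1) ∨
          ∃ a b, a < b ∧ (fun x => x j) '' W i = Set.Ioo a b ∧ e = -1) ∧
        ∀ t, openEuler (W i ∩ {x | x j = t}) =
          openEuler (W i) * e * ((fun x => x j) '' W i).indicator (1 : ℝ → ℤ) t := by
      intro i
      by_cases hi : i ∈ s'
      · obtain ⟨e, he⟩ := openEuler_slice (hW i (hss i hi)) (ho i (hss i hi)) (hb i (hss i hi))
          (Finset.mem_filter.1 hi).2 j
        exact ⟨e, fun _ => he⟩
      · exact ⟨0, fun h => absurd h hi⟩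
    choose e he using key
    have hsum : ∀ f : ι → ℤ, (∀ i ∈ s, ¬ (W i).Nonempty → f i = 0) →
        ∑ i ∈ s, f i = ∑ i ∈ s', f i := by
      intro f hf
      rw [hs', Finset.sum_filter]
      refine Finset.sum_congr rfl fun i hi => ?_
      split_ifs with hi'
      · rfl
      · exact hf i hi hi'
    have hslice : ∀ t, ∑ i ∈ s, c i * openEuler (W i ∩ {x | x j = t}) = 0 := by
      intro t
      refine ih (fun i => W i ∩ {x | x j = t}) (fun i hi => ?_) (fun i hi x hx => ⟨hx, ?_⟩)
        (fun i hi => (hb i hi).subset Set.inter_subset_left) ?_ fun p => ?_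
      · exact (hW i hi).inter ((convex_singleton t).linear_preimage
          (LinearMap.proj j : (Fin n → ℝ) →ₗ[ℝ] ℝ))
      · intro y hy
        obtain ⟨δ, hδ, h⟩ := (ho i hi hx.1).2 y hy.1
        have h1 : x j = t := hx.2
        have h2 : y j = t := hy.2
        exact ⟨δ, hδ, h, by simp [h1, h2]⟩
      · intro i hi i' hi' x hx y hy k hk
        by_cases hkj : k = j
        · rw [hkj, show x j = t from hx.2, show y j = t from hy.2]
        · exact hK i hi i' hi' x hx.1 y hy.1 k (by simp [hkj, hk])
      · by_cases hp : p j = t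
        · rw [← h p]
          refine Finset.sum_congr rfl fun i _ => ?_
          simp [Set.indicator_apply, hp]
        · refine Finset.sum_eq_zero fun i _ => ?_
          simp [hp]
    -- The slice relations, as `t` varies, relate the indicators of the projections with
    -- coefficients `c * openEuler * e`. The line case multiplies by another `e`, and `e * e = 1`.
    have hline := sum_mul_eq_zero_of_sum_indicator_line s' (fun i => c i * (openEuler (W i) * e i)) e
      (fun i => (fun x => x j) '' W i) (fun i hi => (he i hi).1) fun t => by
        rw [← hslice t, hsum _ fun i _ hi => ?_]
        · refine Finset.sum_congr rfl fun i hi => ?_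
          rw [(he i hi).2 t]
          ring
        · rw [Set.not_nonempty_iff_eq_empty.1 hi]
          simp [openEuler]
    rw [hsum _ fun i _ hi => by simp [openEuler, hi], ← hline]
    refine Finset.sum_congr rfl fun i hi => ?_
    have hee : e i * e i = 1 := by
      rcases (he i hi).1 with ⟨_, _, h⟩ | ⟨_, _, _, _, h⟩ <;> simp [h]
    rw [mul_assoc, mul_assoc, hee, mul_one]

/-- A linear relation between the indicator functions of bounded relatively open convex sets holds
between their Euler characteristics. -/
theorem sum_mul_openEuler_eq_zero (s : Finset ι) (c : ι → ℤ)
    (W : ι → Set (Fin n → ℝ)) (hW : ∀ i ∈ s, Convex ℝ (W i))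
    (ho : ∀ i ∈ s, W i ⊆ algRelInt (W i)) (hb : ∀ i ∈ s, Bornology.IsBounded (W i))
    (h : ∀ p, ∑ i ∈ s, c i * (W i).indicator (1 : (Fin n → ℝ) → ℤ) p = 0) :
    ∑ i ∈ s, c i * openEuler (W i) = 0 :=
  sum_mul_openEuler_eq_zero_of_eqOn_compl Finset.univ s c W hW ho hb
    (fun _ _ _ _ _ _ _ _ j hj => absurd (Finset.mem_univ j) hj) h

end Euler

/-! ### Polyhedral subdivisions and their internal faces. -/

section Subdivision

variable {n : ℕ} {D : Set (Set (Fin n → ℝ))} {P Q U : Set (Fin n → ℝ)}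

theorem not_subset_intrinsicFrontier_iff (hP : Convex ℝ P) (hQ : Q ⊆ P) :
    ¬ Q ⊆ intrinsicFrontier ℝ P ↔ (Q ∩ algRelInt P).Nonempty := by
  rw [← intrinsicInterior_eq_algRelInt hP, ← intrinsicClosure_sdiff_intrinsicInterior,
    Set.not_subset, Set.Nonempty]
  refine exists_congr fun x => and_congr_right fun hx => ?_
  rw [Set.mem_sdiff, not_and_not_right]
  exact ⟨fun h => h (subset_intrinsicClosure (hQ hx)), fun h _ => h⟩

theorem openEuler_algRelInt_inter_isOpen [Decidable (P ∩ U).Nonempty] (hP : Convex ℝ P)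
    (hU : IsOpen U) :
    openEuler (algRelInt P ∩ U) = if (P ∩ U).Nonempty then (-1) ^ convexDim P else 0 := by
  by_cases h : (P ∩ U).Nonempty
  · have h' := algRelInt_inter_isOpen_nonempty hP hU h
    rw [openEuler, if_pos h', if_pos h, convexDim, vectorSpan_algRelInt_inter_isOpen hP hU h',
      convexDim]
  · rw [openEuler, if_neg h, if_neg]
    exact fun h' => h (h'.mono (Set.inter_subset_inter_left _ algRelInt_subset))

theorem convexDim_mono (h : Q ⊆ P) : convexDim Q ≤ convexDim P :=
  Submodule.finrank_mono (vectorSpan_mono ℝ h)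

namespace IsPolytopalSubdivision

theorem convex (hD : IsPolytopalSubdivision D P) (hQ : Q ∈ D) : Convex ℝ Q := by
  obtain ⟨V, -, rfl⟩ := hD.isPolytope Q hQ
  exact convex_convexHull ℝ _

theorem subset (hD : IsPolytopalSubdivision D P) (hQ : Q ∈ D) : Q ⊆ P :=
  hD.sUnion_eq ▸ Set.subset_sUnion_of_mem hQ

/-- Together with `exists_mem_algRelInt`, this shows that the relative interiors of the cells
partition `P`. -/
theorem eq_of_mem_algRelInt (hD : IsPolytopalSubdivision D P) {R : Set (Fin n → ℝ)} (hQ : Q ∈ D)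
    (hR : R ∈ D) {p : Fin n → ℝ} (hpQ : p ∈ algRelInt Q) (hpR : p ∈ algRelInt R) : Q = R := by
  obtain ⟨h1, h2⟩ := hD.inter_face Q hQ R hR
  rw [← h1.eq_of_mem_algRelInt ⟨hpQ.1, hpR.1⟩ hpQ, h2.eq_of_mem_algRelInt ⟨hpQ.1, hpR.1⟩ hpR]

theorem exists_mem_algRelInt (hD : IsPolytopalSubdivision D P) {p : Fin n → ℝ} (hp : p ∈ P) :
    ∃ Q ∈ D, p ∈ algRelInt Q := by
  rw [← hD.sUnion_eq] at hp
  obtain ⟨R, hR, hpR⟩ := hp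
  -- In a minimal cell containing `p`, the point lies in the relative interior: otherwise a proper
  -- face through `p` would be a smaller cell.
  obtain ⟨Q, hQ⟩ := (hD.finite.subset (Set.sep_subset D fun Q => p ∈ Q)).exists_minimal ⟨R, hR, hpR⟩
  refine ⟨Q, hQ.prop.1, ?_⟩
  by_contra h
  obtain ⟨F, hF, hpF, hne⟩ :=
    exists_isExposed_of_notMem_algRelInt (hD.convex hQ.prop.1) hQ.prop.2 h
  exact hne (hF.subset.antisymm
    (hQ.le_of_le ⟨hD.face_mem Q hQ.prop.1 F hF ⟨p, hpF⟩, hpF⟩ hF.subset))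

/-- The Euler characteristic of the relative interior of `P`, intersected with an open convex set,
is the sum of those of the relative interiors of the internal faces of a subdivision. -/
theorem openEuler_eq_sum (hD : IsPolytopalSubdivision D P) (hP : Convex ℝ P)
    (hb : Bornology.IsBounded P) (hU : IsOpen U) (hUc : Convex ℝ U)
    (s : Finset (Set (Fin n → ℝ))) (hs : ∀ Q, Q ∈ s ↔ Q ∈ internalFaces D P) :
    openEuler (algRelInt P ∩ U) = ∑ Q ∈ s, openEuler (algRelInt Q ∩ U) := by
  classical
  have hsD : ∀ Q ∈ s, Q ∈ D := fun Q hQ => ((hs Q).1 hQ).1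
  have hint : ∀ Q ∈ s, (Q ∩ algRelInt P).Nonempty := fun Q hQ =>
    (not_subset_intrinsicFrontier_iff hP (hD.subset (hsD Q hQ))).1 ((hs Q).1 hQ).2
  -- The index `none` stands for `P` itself, entering the relation with coefficient `-1`.
  let W : Option (Set (Fin n → ℝ)) → Set (Fin n → ℝ) := fun o => algRelInt (o.getD P) ∩ U
  have hcell : ∀ o ∈ Finset.insertNone s, Convex ℝ (o.getD P) ∧ o.getD P ⊆ P := by
    rintro (_ | Q) ho
    · exact ⟨hP, subset_rfl⟩
    · have hQ := hsD Q (Finset.some_mem_insertNone.1 ho)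
      exact ⟨hD.convex hQ, hD.subset hQ⟩
  have key := sum_mul_openEuler_eq_zero (Finset.insertNone s)
    (fun o => o.elim (-1) fun _ => 1) W
    (fun o ho => (convex_algRelInt (hcell o ho).1).inter hUc)
    (fun o ho => algRelInt_inter_isOpen (hcell o ho).1 hU)
    (fun o ho => hb.subset (Set.inter_subset_left.trans (algRelInt_subset.trans (hcell o ho).2)))
    fun p => ?_
  · rw [Finset.sum_insertNone] at key
    simp only [Option.elim, W, Option.getD_none, Option.getD_some, one_mul] at key
    linarith
  · rw [Finset.sum_insertNone]
    simp only [Option.elim, W, Option.getD_none, Option.getD_some, one_mul]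
    by_cases hpU : p ∈ U
    swap
    · simp [hpU]
    simp only [Set.indicator_apply, Set.mem_inter_iff, hpU, and_true, Pi.one_apply]
    by_cases hp : p ∈ algRelInt P
    · obtain ⟨Q, hQ, hpQ⟩ := hD.exists_mem_algRelInt hp.1
      have hQs : Q ∈ s := (hs Q).2 ⟨hQ, (not_subset_intrinsicFrontier_iff hP (hD.subset hQ)).2
        ⟨p, hpQ.1, hp⟩⟩
      rw [if_pos hp, Finset.sum_eq_single_of_mem Q hQs, if_pos hpQ]
      · norm_num
      · exact fun R hR hne => if_neg fun h => hne (hD.eq_of_mem_algRelInt (hsD R hR) hQ h hpQ)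
    · rw [if_neg hp, Finset.sum_eq_zero, mul_zero, add_zero]
      exact fun Q hQ => if_neg fun h => hp (algRelInt_subset_algRelInt hP (hD.subset (hsD Q hQ))
        (hint Q hQ) h)

end IsPolytopalSubdivision

end Subdivision

/-! ### Matroid polytopes and rank functions. -/

theorem isLinearMap_sum_apply {n : ℕ} (S : Finset (Fin n)) :
    IsLinearMap ℝ fun x : Fin n → ℝ => ∑ i ∈ S, x i :=
  ⟨fun x y => by simp [Finset.sum_add_distrib], fun c x => by simp [Finset.mul_sum]⟩

namespace MatroidOn

variable {n : ℕ} (M N : MatroidOn n)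

theorem convex_polytope : Convex ℝ M.polytope := convex_convexHull ℝ _

theorem indicator_mem_polytope {M : MatroidOn n} {B : Set (Fin n)} (hB : M.1.IsBase B) :
    B.indicator 1 ∈ M.polytope :=
  subset_convexHull ℝ _ ⟨B, hB, rfl⟩

theorem isBounded_polytope : Bornology.IsBounded M.polytope := by
  refine isBounded_convexHull.2 (Set.Finite.isBounded ?_)
  refine (Set.finite_range fun B : Set (Fin n) => B.indicator (1 : Fin n → ℝ)).subset ?_
  rintro _ ⟨B, -, rfl⟩
  exact ⟨B, rfl⟩

/-- On the cube, the `ℓ¹` distance to the indicator of `B` is affine. It is at least `1` at every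
other 0/1 vector, so it would be at least `1` on the whole polytope if `B` were not a base. -/
theorem isBase_of_indicator_mem_polytope {M : MatroidOn n} {B : Set (Fin n)}
    (h : B.indicator 1 ∈ M.polytope) : M.1.IsBase B := by
  classical
  by_contra hB
  have hsub : M.polytope ⊆ {x | 1 ≤ ∑ i, if i ∈ B then 1 - x i else x i} := by
    refine convexHull_min ?_ ?_
    · rintro _ ⟨C, hC, rfl⟩
      have hne : B ≠ C := fun h => hB (h ▸ hC)
      obtain ⟨i, hi⟩ : ∃ i, ¬ (i ∈ B ↔ i ∈ C) := by
        by_contra! h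
        exact hne (Set.ext h)
      have h1 : (if i ∈ B then 1 - C.indicator (1 : Fin n → ℝ) i else C.indicator 1 i) = 1 := by
        by_cases h1 : i ∈ B <;> by_cases h2 : i ∈ C <;> simp_all
      rw [Set.mem_ofPred_eq]
      refine h1.symm.le.trans <| Finset.single_le_sum
        (f := fun i => if i ∈ B then 1 - C.indicator (1 : Fin n → ℝ) i else C.indicator 1 i)
        (fun k _ => ?_) (Finset.mem_univ i)
      by_cases h1 : k ∈ B <;> by_cases h2 : k ∈ C <;> simp [h1, h2]
    · intro x hx y hy a b ha hb hab
      have : (∑ i, if i ∈ B then 1 - (a • x + b • y) i else (a • x + b • y) i) =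
          a * (∑ i, if i ∈ B then 1 - x i else x i) +
            b * ∑ i, if i ∈ B then 1 - y i else y i := by
        rw [Finset.mul_sum, Finset.mul_sum, ← Finset.sum_add_distrib]
        refine Finset.sum_congr rfl fun i _ => ?_
        split_ifs
        · simp only [Pi.add_apply, Pi.smul_apply, smul_eq_mul]
          linear_combination -hab
        · simp
      rw [Set.mem_ofPred_eq] at hx hy ⊢
      rw [this]
      nlinarith
  have h1 := hsub h
  rw [Set.mem_ofPred_eq, Finset.sum_eq_zero fun i _ => ?_] at h1
  · norm_num at h1
  · by_cases hi : i ∈ B <;> simp [hi]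

/-- Allows sums over internal cells to be rewritten as sums over matroids. -/
theorem polytope_injective : Function.Injective (polytope (n := n)) := by
  intro M N h
  refine Subtype.ext (Matroid.ext_isBase (M.2.trans N.2.symm) fun B _ => ⟨fun hB => ?_, fun hB => ?_⟩)
  · exact isBase_of_indicator_mem_polytope (h ▸ indicator_mem_polytope hB)
  · exact isBase_of_indicator_mem_polytope (h ▸ indicator_mem_polytope hB)

theorem eRk_ne_top (S : Finset (Fin n)) : M.1.eRk S ≠ ⊤ :=
  ne_top_of_le_ne_top (by simp) (M.1.eRk_le_encard (S : Set (Fin n)))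

theorem rk_le_card (S : Finset (Fin n)) : M.rk S ≤ S.card := by
  have := M.1.eRk_le_encard (S : Set (Fin n))
  rw [Set.encard_coe_eq_coe_finsetCard] at this
  exact ENat.toNat_le_of_le_natCast this

theorem rk_le (S : Finset (Fin n)) : M.rk S ≤ n :=
  (M.rk_le_card S).trans (card_finset_fin_le S)

theorem rank_eq_of_polytope_subset {M N : MatroidOn n} (h : N.polytope ⊆ M.polytope) :
    N.rank = M.rank := by
  obtain ⟨B, hB⟩ := N.1.exists_isBase
  have hB' := isBase_of_indicator_mem_polytope (h (indicator_mem_polytope hB))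
  unfold rank rk
  rw [Finset.coe_univ, Matroid.eRk_univ_eq, Matroid.eRk_univ_eq, ← hB.encard_eq_eRank,
    ← hB'.encard_eq_eRank]

open Classical in
theorem sum_indicator_eq (B : Set (Fin n)) (S : Finset (Fin n)) :
    ∑ i ∈ S, B.indicator (1 : Fin n → ℝ) i = ((S.filter (· ∈ B)).card : ℝ) := by
  simp [Set.indicator_apply]

theorem card_filter_le_rk {M : MatroidOn n} {B : Set (Fin n)} [DecidablePred (· ∈ B)]
    (hB : M.1.Indep B) (S : Finset (Fin n)) : (S.filter (· ∈ B)).card ≤ M.rk S := by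
  have h := (hB.subset (I := (S.filter (· ∈ B) : Finset (Fin n))) fun i hi =>
    (Finset.mem_filter.1 hi).2).encard_le_eRk_of_subset (X := S)
      fun i hi => (Finset.mem_filter.1 hi).1
  rw [Set.encard_coe_eq_coe_finsetCard, ← ENat.natCast_toNat (M.eRk_ne_top S)] at h
  exact_mod_cast h

theorem rk_le_card_filter {M : MatroidOn n} {I B : Set (Fin n)} [DecidablePred (· ∈ B)]
    {S : Finset (Fin n)} (hI : M.1.IsBasis I S) (hIB : I ⊆ B) :
    M.rk S ≤ (S.filter (· ∈ B)).card := by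
  unfold rk
  rw [← hI.encard_eq_eRk]
  refine ENat.toNat_le_of_le_natCast ?_
  rw [← Set.encard_coe_eq_coe_finsetCard]
  refine Set.encard_le_encard fun i hi => ?_
  simpa using ⟨hI.subset hi, hIB hi⟩

theorem sum_le_rk_of_mem_polytope {M : MatroidOn n} {x : Fin n → ℝ} (hx : x ∈ M.polytope)
    (S : Finset (Fin n)) : ∑ i ∈ S, x i ≤ M.rk S := by
  classical
  have hsub : M.polytope ⊆ {x | ∑ i ∈ S, x i ≤ M.rk S} := by
    refine convexHull_min ?_ ?_
    · rintro _ ⟨B, hB, rfl⟩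
      rw [Set.mem_ofPred_eq, sum_indicator_eq]
      exact_mod_cast card_filter_le_rk hB.indep S
    · exact convex_halfSpace_le (isLinearMap_sum_apply S) _
  exact hsub hx

/-- For `S ⊆ T` a single base computes the ranks of both sets. -/
theorem exists_mem_polytope_sum_eq_rk {S T : Finset (Fin n)} (hST : S ⊆ T) :
    ∃ x ∈ M.polytope, ∑ i ∈ S, x i = M.rk S ∧ ∑ i ∈ T, x i = M.rk T := by
  classical
  have hE : ∀ X : Set (Fin n), X ⊆ M.1.E := fun X => M.2.symm ▸ Set.subset_univ X
  obtain ⟨I, hI⟩ := M.1.exists_isBasis (S : Set (Fin n)) (hE _)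
  obtain ⟨J, hJ, hIJ⟩ := hI.indep.subset_isBasis_of_subset
    (hI.subset.trans (Finset.coe_subset.2 hST)) (hE _)
  obtain ⟨B, hB, hJB⟩ := hJ.indep.exists_isBase_superset
  refine ⟨_, indicator_mem_polytope hB, ?_, ?_⟩
  · rw [sum_indicator_eq]
    exact_mod_cast (card_filter_le_rk hB.indep S).antisymm (rk_le_card_filter hI (hIJ.trans hJB))
  · rw [sum_indicator_eq]
    exact_mod_cast (card_filter_le_rk hB.indep T).antisymm (rk_le_card_filter hJ hJB)

end MatroidOn

/-! ### The valuative relation for pairs of ranks. -/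

/-- The points at which the coordinate sums over `S` and `T` exceed `a - 1/2` and `b - 1/2`. -/
def sumExceeds {n : ℕ} (S T : Finset (Fin n)) (a b : ℕ) : Set (Fin n → ℝ) :=
  {x | (a : ℝ) - 1 / 2 < ∑ i ∈ S, x i} ∩ {x | (b : ℝ) - 1 / 2 < ∑ i ∈ T, x i}

section Valuative

variable {n : ℕ}

theorem isOpen_sumExceeds (S T : Finset (Fin n)) (a b : ℕ) : IsOpen (sumExceeds S T a b) :=
  (isOpen_lt continuous_const (by fun_prop)).inter (isOpen_lt continuous_const (by fun_prop))

theorem convex_sumExceeds (S T : Finset (Fin n)) (a b : ℕ) : Convex ℝ (sumExceeds S T a b) := by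
  exact (convex_halfSpace_gt (isLinearMap_sum_apply S) _).inter
    (convex_halfSpace_gt (isLinearMap_sum_apply T) _)

/-- The maxima of the two coordinate sums over the polytope are the integers `rk S` and `rk T`,
attained together. The shift by `1 / 2` makes the integer inequalities `≥` into open conditions. -/
theorem MatroidOn.polytope_inter_sumExceeds_nonempty (M : MatroidOn n) {S T : Finset (Fin n)}
    (hST : S ⊆ T) (a b : ℕ) :
    (M.polytope ∩ sumExceeds S T a b).Nonempty ↔ a ≤ M.rk S ∧ b ≤ M.rk T := by
  constructor
  · rintro ⟨x, hx, hS, hT⟩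
    have hS : (a : ℝ) - 1 / 2 < ∑ i ∈ S, x i := hS
    have hT : (b : ℝ) - 1 / 2 < ∑ i ∈ T, x i := hT
    have h1 : (a : ℝ) < (M.rk S + 1 : ℕ) := by
      push_cast
      linarith [sum_le_rk_of_mem_polytope hx S]
    have h2 : (b : ℝ) < (M.rk T + 1 : ℕ) := by
      push_cast
      linarith [sum_le_rk_of_mem_polytope hx T]
    exact ⟨Nat.lt_succ_iff.1 (Nat.cast_lt.1 h1), Nat.lt_succ_iff.1 (Nat.cast_lt.1 h2)⟩
  · rintro ⟨ha, hb⟩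
    obtain ⟨x, hx, hS, hT⟩ := M.exists_mem_polytope_sum_eq_rk hST
    have h1 : (a : ℝ) ≤ M.rk S := by exact_mod_cast ha
    have h2 : (b : ℝ) ≤ M.rk T := by exact_mod_cast hb
    refine ⟨x, hx, ?_, ?_⟩
    · change (a : ℝ) - 1 / 2 < ∑ i ∈ S, x i
      linarith
    · change (b : ℝ) - 1 / 2 < ∑ i ∈ T, x i
      linarith

namespace IsMatroidalSubdivision

variable {D : Set (Set (Fin n → ℝ))} {M : MatroidOn n} {S T : Finset (Fin n)}

open Classical in
theorem rank_ge_eq_sum (hD : IsMatroidalSubdivision D M) (hST : S ⊆ T) (a b : ℕ) :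
    (if a ≤ M.rk S ∧ b ≤ M.rk T then 1 else 0 : ℤ) =
      ∑ N : MatroidOn n with N.polytope ∈ internalFaces D M.polytope,
        (-1 : ℤ) ^ (convexDim M.polytope - convexDim N.polytope) *
          if a ≤ N.rk S ∧ b ≤ N.rk T then 1 else 0 := by
  have hU := isOpen_sumExceeds S T a b
  have heul : ∀ N : MatroidOn n, openEuler (algRelInt N.polytope ∩ sumExceeds S T a b) =
      (-1) ^ convexDim N.polytope * if a ≤ N.rk S ∧ b ≤ N.rk T then 1 else 0 := by
    intro N
    rw [openEuler_algRelInt_inter_isOpen N.convex_polytope hU, mul_ite, mul_one, mul_zero]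
    simp only [N.polytope_inter_sumExceeds_nonempty hST]
  set s := Finset.univ.filter fun N : MatroidOn n => N.polytope ∈ internalFaces D M.polytope
  have h := hD.subdivision.openEuler_eq_sum M.convex_polytope M.isBounded_polytope hU
    (convex_sumExceeds S T a b) (s.image MatroidOn.polytope) fun Q => by
      constructor
      · intro hQ
        obtain ⟨N, hN, rfl⟩ := Finset.mem_image.1 hQ
        exact (Finset.mem_filter.1 hN).2
      · intro hQ
        obtain ⟨N, rfl⟩ := hD.matroidal Q hQ.1
        exact Finset.mem_image_of_mem _ (Finset.mem_filter.2 ⟨Finset.mem_univ N, hQ⟩)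
  rw [Finset.sum_image MatroidOn.polytope_injective.injOn, heul] at h
  simp only [heul] at h
  -- Multiplying by the sign of `M` turns `(-1) ^ dim N` into `(-1) ^ (dim M - dim N)`, as `dim N ≤
  -- dim M`.
  have hsq : ((-1 : ℤ) ^ convexDim M.polytope) * (-1) ^ convexDim M.polytope = 1 := by
    rw [← mul_pow]
    simp
  have h' := congrArg ((-1 : ℤ) ^ convexDim M.polytope * ·) h
  simp only [← mul_assoc, hsq, one_mul] at h'
  rw [h', Finset.mul_sum]
  refine Finset.sum_congr rfl fun N hN => ?_
  have hle : convexDim N.polytope ≤ convexDim M.polytope :=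
    convexDim_mono (hD.subdivision.subset (Finset.mem_filter.1 hN).2.1)
  rw [← mul_assoc]
  congr 1
  obtain ⟨k, hk⟩ := Nat.exists_eq_add_of_le hle
  rw [hk, Nat.add_sub_cancel_left, pow_add, mul_right_comm, ← mul_pow]
  simp

open Classical in
theorem rank_eq_eq_sum (hD : IsMatroidalSubdivision D M) (hST : S ⊆ T) (a b : ℕ) :
    (if M.rk S = a ∧ M.rk T = b then 1 else 0 : ℤ) =
      ∑ N : MatroidOn n with N.polytope ∈ internalFaces D M.polytope,
        (-1 : ℤ) ^ (convexDim M.polytope - convexDim N.polytope) *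
          if N.rk S = a ∧ N.rk T = b then 1 else 0 := by
  -- Inclusion-exclusion over the two thresholds.
  have hE : ∀ k l : ℕ, (if k = a ∧ l = b then 1 else 0 : ℤ) =
      (if a ≤ k ∧ b ≤ l then 1 else 0) - (if a + 1 ≤ k ∧ b ≤ l then 1 else 0) -
        (if a ≤ k ∧ b + 1 ≤ l then 1 else 0) + if a + 1 ≤ k ∧ b + 1 ≤ l then 1 else 0 := by
    intro k l
    split_ifs <;> omega
  simp only [hE, mul_add, mul_sub, Finset.sum_add_distrib, Finset.sum_sub_distrib,
    ← hD.rank_ge_eq_sum hST]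

open Classical in
/-- Every function of the ranks of two nested sets satisfies the valuative relation. -/
theorem apply_rk_rk_eq_sum (hD : IsMatroidalSubdivision D M) (hST : S ⊆ T) {A : Type*}
    [AddCommGroup A] (g : ℕ → ℕ → A) :
    g (M.rk S) (M.rk T) = ∑ N : MatroidOn n with N.polytope ∈ internalFaces D M.polytope,
      (-1 : ℤ) ^ (convexDim M.polytope - convexDim N.polytope) • g (N.rk S) (N.rk T) := by
  -- Ranks are at most `n`, so `g` expands as a finite combination of indicators of rank pairs.
  have hg : ∀ N : MatroidOn n, g (N.rk S) (N.rk T) =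
      ∑ q ∈ Finset.range (n + 1) ×ˢ Finset.range (n + 1),
        (if N.rk S = q.1 ∧ N.rk T = q.2 then 1 else 0 : ℤ) • g q.1 q.2 := by
    intro N
    rw [Finset.sum_eq_single_of_mem (N.rk S, N.rk T)]
    · simp
    · simp [N.rk_le]
    · rintro ⟨a, b⟩ - hne
      rw [if_neg, zero_smul]
      rintro ⟨rfl, rfl⟩
      exact hne rfl
  simp only [hg, Finset.smul_sum, smul_smul]
  rw [Finset.sum_comm]
  refine Finset.sum_congr rfl fun q _ => ?_
  rw [← Finset.sum_smul, ← hD.rank_eq_eq_sum hST]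

end IsMatroidalSubdivision

theorem isValuative_tutteLike : IsValuative fun M : MatroidOn n => tutteLike M := by
  classical
  intro M D hD
  have hrank : ∀ N ∈ Finset.univ.filter
      (fun N : MatroidOn n => N.polytope ∈ internalFaces D M.polytope), N.rank = M.rank :=
    fun N hN => MatroidOn.rank_eq_of_polytope_subset
      (hD.subdivision.subset (Finset.mem_filter.1 hN).2.1)
  simp only [tutteLike, Finset.smul_sum]
  rw [Finset.sum_comm]
  refine Finset.sum_congr rfl fun T _ => ?_
  rw [Finset.sum_comm]
  refine Finset.sum_congr rfl fun S hS => ?_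
  -- The total rank is frozen at `M.rank`, so that the summand depends on two ranks only; `hrank`
  -- restores `N.rank`.
  refine (hD.apply_rk_rk_eq_sum (Finset.mem_powerset.1 hS) fun a b =>
    (MvPolynomial.X 0 ^ (S.card - a) * MvPolynomial.X 1 ^ (M.rank - b) *
      MvPolynomial.X 2 ^ (T.card - S.card) : MvPolynomial (Fin 3) ℤ)).trans
    (Finset.sum_congr rfl fun N hN => ?_)
  rw [hrank N hN]

/-! ### The Tutte specialization. -/

open MvPolynomial in
theorem aeval_tutteLike (M : MatroidOn n) :
    aeval (![X 0 - 1, X 1 - 1, 0] : Fin 3 → MvPolynomial (Fin 2) ℤ) (tutteLike M) =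
      aeval (![X 1, X 0] : Fin 2 → MvPolynomial (Fin 2) ℤ) (tuttePolynomial M) := by
  simp only [tutteLike, tuttePolynomial, map_sum, map_mul, map_pow, map_sub, map_one, aeval_X]
  refine Finset.sum_congr rfl fun T _ => ?_
  -- The factor `0 ^ (#T - #S)` is `1` for `S = T` and vanishes for proper subsets.
  rw [Finset.sum_eq_single_of_mem T (Finset.mem_powerset_self T)]
  · simp [mul_comm]
  · intro S hS hne
    have hlt : S.card < T.card :=
      Finset.card_lt_card ((Finset.mem_powerset.1 hS).ssubset_of_ne hne)
    simp [Nat.sub_ne_zero_of_lt hlt]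

end Valuative

theorem lemma5p3 (n : ℕ) :
    IsValuative (fun M : MatroidOn n => tutteLike M) ∧
    ∀ M : MatroidOn n,
      MvPolynomial.aeval
          (![MvPolynomial.X 0 - 1, MvPolynomial.X 1 - 1, 0] : Fin 3 → MvPolynomial (Fin 2) ℤ)
          (tutteLike M) =
        MvPolynomial.aeval
          (![MvPolynomial.X 1, MvPolynomial.X 0] : Fin 2 → MvPolynomial (Fin 2) ℤ)
          (tuttePolynomial M) :=
  ⟨isValuative_tutteLike, aeval_tutteLike⟩
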